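/- Let $L$ be a distributive lattice with $|L|\ge 2$, and let $\mathrm{FBL}\langle L\rangle$ be the free Banach lattice generated by $L$, that is, a Banach lattice with a bounded lattice homomorphism $\delta_L:L\to\mathrm{FBL}\langle L\rangle$ such that for every Banach lattice $Y$ and every bounded lattice homomorphism $T:L\to Y$ there is a unique Banach lattice homomorphism (bounded linear lattice homomorphism) $\widehat T:\mathrm{FBL}\langle L\rangle\to Y$ with $\widehat T\circ\delta_L=T$ and $\|\widehat T\|=\sup_{x\in L}\|Tx\|$. Its concrete realization is the following: let $L^*$ be the set of all lattice homomorphisms $x^*:L\to[-1,1]$, and for positively homogeneous $f:L^*\to\mathbb R$ (i.e. $f(\lambda x^*)=\lambda f(x^*)$ whenever $\lambda\ge 0$ and $x^*,\lambda x^*\in L^*$) put $$\|f\|=\sup\Big\{\sum_{i=1}^m|f(x_i^*)| : m\in\mathbb N,\ x_1^*,\dots,x_m^*\in L^*,\ \sup_{x\in L}\sum_{i=1}^m|x_i^*(x)|\le 1\Big\};$$ the realization is the smallest norm closed vector sublattice, containing all evaluations $\delta_x(x^*)=x^*(x)$ $(x\in L)$, of the space of all positively homogeneous $f$ with $\|f\|<\infty$,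 with pointwise operations and order. Then, both for this concrete realization and for every Banach lattice with the universal property above: 1. $\mathrm{FBL}\langle L\rangle$ is not Dedekind $\sigma$-complete, i.e. some non-empty countable subset that is bounded above has no supremum. 2. The norm of $\mathrm{FBL}\langle L\rangle$ is not order continuous, i.e. some non-empty downward directed set with infimum $0$ does not converge to $0$ in norm. 3. $\mathrm{FBL}\langle L\rangle$ has no atoms, i.e. there is no $a>0$ such that every $x$ with $0\le x\le a$ is a scalar multiple of $a$. -/

import Mathlib

universe u

namespace FreeBL

section Order

/-- A vector lattice is Dedekind `σ`-complete if every non-empty countable subset that is bounded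
above has a supremum. -/
def DedekindSigmaComplete (X : Type*) [Lattice X] : Prop :=
  ∀ s : Set X, s.Nonempty → s.Countable → BddAbove s → ∃ a, IsLUB s a

/-- The norm is order continuous if every downward directed set with infimum `0`, regarded as a
decreasing net, converges to `0` in norm. -/
def OrderContinuousNorm (X : Type*) [NormedAddCommGroup X] [Lattice X] : Prop :=
  ∀ A : Set X, A.Nonempty → DirectedOn (fun a b => b ≤ a) A → IsGLB A 0 →
    ∀ ε : ℝ, 0 < ε → ∃ a ∈ A, ∀ b ∈ A, b ≤ a → ‖b‖ < ε

/-- An atom of a vector lattice: an element `a > 0` such that every `x` with `0 ≤ x ≤ a` is a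
scalar multiple of `a`. -/
def IsVectorAtom {X : Type*} [AddCommGroup X] [Module ℝ X] [Lattice X] (a : X) : Prop :=
  0 < a ∧ ∀ x : X, 0 ≤ x → x ≤ a → ∃ r : ℝ, x = r • a

end Order

section Universal

/-- A Banach lattice homomorphism: a bounded linear map that preserves suprema and infima. -/
def IsBanachLatticeHom {X Y : Type*} [NormedAddCommGroup X] [NormedSpace ℝ X] [Lattice X]
    [NormedAddCommGroup Y] [NormedSpace ℝ Y] [Lattice Y] (T : X →L[ℝ] Y) : Prop :=
  ∀ f g : X, T (f ⊔ g) = T f ⊔ T g ∧ T (f ⊓ g) = T f ⊓ T g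

/-- The universal property that defines the free Banach lattice generated by a lattice `L`:
the lattice homomorphism `δ : L → X` is bounded, and every bounded lattice homomorphism `T`
from `L` to a Banach lattice `Y` factors through `δ` by a unique Banach lattice homomorphism
of norm `sup ‖T x‖`. -/
def IsFreeBanachLattice {L X : Type u} [Lattice L] [NormedAddCommGroup X] [NormedSpace ℝ X]
    [CompleteSpace X] [Lattice X] [IsOrderedAddMonoid X] [IsOrderedModule ℝ X] [HasSolidNorm X]
    (δ : LatticeHom L X) : Prop :=
  BddAbove (Set.range fun x => ‖δ x‖) ∧
  ∀ (Y : Type u) [NormedAddCommGroup Y] [NormedSpace ℝ Y] [CompleteSpace Y] [Lattice Y]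
    [IsOrderedAddMonoid Y] [IsOrderedModule ℝ Y] [HasSolidNorm Y] (T : LatticeHom L Y),
    BddAbove (Set.range fun x => ‖T x‖) →
      ∃! S : X →L[ℝ] Y, IsBanachLatticeHom S ∧ (∀ x, S (δ x) = T x) ∧ ‖S‖ = ⨆ x, ‖T x‖

end Universal

section Construction

variable (L : Type u) [Lattice L]

/-- `L^*`, the set of all lattice homomorphisms from `L` to `[-1, 1]`. -/
abbrev Dual : Type u := LatticeHom L (Set.Icc (-1 : ℝ) 1)

variable {L}

/-- `f (c φ) = c f(φ)` whenever `c ≥ 0` and both `φ` and `c φ` belong to `L^*`. -/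
def PosHomogeneous (f : Dual L → ℝ) : Prop :=
  ∀ (φ ψ : Dual L) (c : ℝ), 0 ≤ c → (∀ x, (ψ x : ℝ) = c * (φ x : ℝ)) → f ψ = c * f φ

/-- The set of all sums `∑ |f(φ_i)|` over finite families in `L^*` with
`∑ |φ_i(x)| ≤ 1` for all `x`. -/
def normSums (f : Dual L → ℝ) : Set ℝ :=
  {s | ∃ (m : ℕ) (φ : Fin m → Dual L),
    (∀ x, ∑ i, |(φ i x : ℝ)| ≤ 1) ∧ s = ∑ i, |f (φ i)|}

/-- The norm of the free Banach lattice, for functions on `L^*`. -/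
noncomputable def fblNorm (f : Dual L → ℝ) : ℝ := sSup (normSums f)

theorem normSums_nonempty (f : Dual L → ℝ) : (normSums f).Nonempty :=
  ⟨0, 0, fun i => i.elim0, by simp, by simp⟩

theorem sum_le_fblNorm {f : Dual L → ℝ} (hf : BddAbove (normSums f)) {m : ℕ} {φ : Fin m → Dual L}
    (hφ : ∀ x, ∑ i, |(φ i x : ℝ)| ≤ 1) : ∑ i, |f (φ i)| ≤ fblNorm f :=
  le_csSup hf ⟨m, φ, hφ, rfl⟩

theorem fblNorm_le {f : Dual L → ℝ} {C : ℝ}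
    (h : ∀ (m : ℕ) (φ : Fin m → Dual L), (∀ x, ∑ i, |(φ i x : ℝ)| ≤ 1) →
      ∑ i, |f (φ i)| ≤ C) : fblNorm f ≤ C :=
  csSup_le (normSums_nonempty f) (by rintro s ⟨m, φ, hφ, rfl⟩; exact h m φ hφ)

theorem bddAbove_normSums {f : Dual L → ℝ} {C : ℝ}
    (h : ∀ (m : ℕ) (φ : Fin m → Dual L), (∀ x, ∑ i, |(φ i x : ℝ)| ≤ 1) →
      ∑ i, |f (φ i)| ≤ C) : BddAbove (normSums f) :=
  ⟨C, by rintro s ⟨m, φ, hφ, rfl⟩; exact h m φ hφ⟩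

theorem fblNorm_nonneg (f : Dual L → ℝ) : 0 ≤ fblNorm f :=
  Real.sSup_nonneg (by
    rintro s ⟨m, φ, -, rfl⟩
    exact Finset.sum_nonneg fun _ _ => abs_nonneg _)

theorem abs_le_fblNorm {f : Dual L → ℝ} (hf : BddAbove (normSums f)) (φ : Dual L) :
    |f φ| ≤ fblNorm f := by
  have := sum_le_fblNorm hf (m := 1) (φ := fun _ => φ) (by
    intro x
    simpa using abs_le.2 (φ x).2)
  simpa using this

theorem sum_add_le {f g : Dual L → ℝ} (hf : BddAbove (normSums f)) (hg : BddAbove (normSums g))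
    {m : ℕ} {φ : Fin m → Dual L} (hφ : ∀ x, ∑ i, |(φ i x : ℝ)| ≤ 1) :
    ∑ i, |(f + g) (φ i)| ≤ fblNorm f + fblNorm g :=
  calc ∑ i, |(f + g) (φ i)| ≤ ∑ i, (|f (φ i)| + |g (φ i)|) :=
        Finset.sum_le_sum fun _ _ => abs_add_le _ _
    _ ≤ fblNorm f + fblNorm g := by
        rw [Finset.sum_add_distrib]
        exact add_le_add (sum_le_fblNorm hf hφ) (sum_le_fblNorm hg hφ)

theorem sum_smul_le {f : Dual L → ℝ} (hf : BddAbove (normSums f)) (c : ℝ)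
    {m : ℕ} {φ : Fin m → Dual L} (hφ : ∀ x, ∑ i, |(φ i x : ℝ)| ≤ 1) :
    ∑ i, |(c • f) (φ i)| ≤ |c| * fblNorm f := by
  simp only [Pi.smul_apply, smul_eq_mul, abs_mul, ← Finset.mul_sum]
  exact mul_le_mul_of_nonneg_left (sum_le_fblNorm hf hφ) (abs_nonneg c)

variable (L)

/-- The positively homogeneous functions of finite norm on `L^*`, as a subspace of `ℝ^(L^*)`. -/
def HSub : Submodule ℝ (Dual L → ℝ) where
  carrier := {f | PosHomogeneous f ∧ BddAbove (normSums f)}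
  zero_mem' := ⟨fun _ _ _ _ _ => by simp, bddAbove_normSums (C := 0) (by simp)⟩
  add_mem' := by
    rintro f g ⟨hf, hf'⟩ ⟨hg, hg'⟩
    refine ⟨fun φ ψ c hc h => ?_, bddAbove_normSums fun m φ hφ => sum_add_le hf' hg' hφ⟩
    simp only [Pi.add_apply, hf φ ψ c hc h, hg φ ψ c hc h]
    ring
  smul_mem' := by
    rintro r f ⟨hf, hf'⟩
    refine ⟨fun φ ψ c hc h => ?_, bddAbove_normSums fun m φ hφ => sum_smul_le hf' r hφ⟩
    simp only [Pi.smul_apply, smul_eq_mul, hf φ ψ c hc h]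
    ring

variable {L}

theorem HSub.abs_sup_le (a b : ℝ) : |a ⊔ b| ≤ |a| + |b| := by
  rcases le_total a b with h | h <;> simp [h]

theorem HSub.abs_inf_le (a b : ℝ) : |a ⊓ b| ≤ |a| + |b| := by
  rcases le_total a b with h | h <;> simp [h]

theorem HSub.sup_mem {f g : Dual L → ℝ} (hf : f ∈ HSub L) (hg : g ∈ HSub L) : f ⊔ g ∈ HSub L := by
  refine ⟨fun φ ψ c hc h => ?_, bddAbove_normSums (C := fblNorm f + fblNorm g) fun m φ hφ => ?_⟩
  · simp only [Pi.sup_apply, hf.1 φ ψ c hc h, hg.1 φ ψ c hc h]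
    exact (mul_max_of_nonneg _ _ hc).symm
  · refine (Finset.sum_le_sum fun i _ => HSub.abs_sup_le (f (φ i)) (g (φ i))).trans ?_
    rw [Finset.sum_add_distrib]
    exact add_le_add (sum_le_fblNorm hf.2 hφ) (sum_le_fblNorm hg.2 hφ)

theorem HSub.inf_mem {f g : Dual L → ℝ} (hf : f ∈ HSub L) (hg : g ∈ HSub L) : f ⊓ g ∈ HSub L := by
  refine ⟨fun φ ψ c hc h => ?_, bddAbove_normSums (C := fblNorm f + fblNorm g) fun m φ hφ => ?_⟩
  · simp only [Pi.inf_apply, hf.1 φ ψ c hc h, hg.1 φ ψ c hc h]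
    exact (mul_min_of_nonneg _ _ hc).symm
  · refine (Finset.sum_le_sum fun i _ => HSub.abs_inf_le (f (φ i)) (g (φ i))).trans ?_
    rw [Finset.sum_add_distrib]
    exact add_le_add (sum_le_fblNorm hf.2 hφ) (sum_le_fblNorm hg.2 hφ)

variable (L)

/-- The space of all positively homogeneous functions of finite norm on `L^*`. It is a type of its
own, so that its only topology is the one of the norm `fblNorm` (not the one of pointwise
convergence). -/
def HFun : Type u := HSub L

variable {L}

instance : AddCommGroup (HFun L) := inferInstanceAs (AddCommGroup (HSub L))

instance : Module ℝ (HFun L) := inferInstanceAs (Module ℝ (HSub L))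

/-- The order of `HFun L` is the pointwise order. -/
instance : Lattice (HFun L) :=
  Subtype.lattice (P := fun f => f ∈ HSub L) (fun _ _ hf hg => HSub.sup_mem hf hg)
    (fun _ _ hf hg => HSub.inf_mem hf hg)

noncomputable instance : Norm (HFun L) := ⟨fun f => fblNorm f.1⟩

theorem HFun.core : NormedSpace.Core ℝ (HFun L) where
  norm_nonneg f := fblNorm_nonneg _
  norm_smul c f := by
    have key : ∀ (c : ℝ) (f : HFun L), ‖c • f‖ ≤ |c| * ‖f‖ := fun c f =>
      fblNorm_le fun m φ hφ => sum_smul_le f.2.2 c hφ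
    refine le_antisymm (key c f) ?_
    rcases eq_or_ne c 0 with rfl | hc
    · rw [norm_zero, zero_mul]
      exact fblNorm_nonneg _
    · have h := key c⁻¹ (c • f)
      rw [inv_smul_smul₀ hc, abs_inv] at h
      rwa [Real.norm_eq_abs, ← le_inv_mul_iff₀ (abs_pos.2 hc)]
  norm_triangle f g := fblNorm_le fun m φ hφ => sum_add_le f.2.2 g.2.2 hφ
  norm_eq_zero_iff f := by
    constructor
    · intro h
      refine Subtype.ext (funext fun φ => ?_)
      have h1 := abs_le_fblNorm f.2.2 φ
      have h2 : fblNorm f.1 = 0 := h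
      rw [h2] at h1
      exact abs_eq_zero.1 (le_antisymm h1 (abs_nonneg _))
    · rintro rfl
      refine le_antisymm (fblNorm_le fun m φ _ => ?_) (fblNorm_nonneg _)
      have h0 : ∀ ψ : Dual L, (0 : HFun L).1 ψ = 0 := fun _ => rfl
      simp [h0]

noncomputable instance : NormedAddCommGroup (HFun L) := NormedAddCommGroup.ofCore HFun.core

noncomputable instance : NormedSpace ℝ (HFun L) := NormedSpace.ofCore HFun.core

instance : IsOrderedAddMonoid (HFun L) where
  add_le_add_left _ _ h c φ := add_le_add_left (h φ) (c.1 φ)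

instance : IsOrderedModule ℝ (HFun L) where
  smul_le_smul_of_nonneg_left _ hc _ _ h φ := mul_le_mul_of_nonneg_left (h φ) hc
  smul_le_smul_of_nonneg_right _ hf _ _ h φ := mul_le_mul_of_nonneg_right h (hf φ)

instance : HasSolidNorm (HFun L) where
  solid {_ g} h := fblNorm_le fun _ φ hφ =>
    (Finset.sum_le_sum fun i _ => h (φ i)).trans (sum_le_fblNorm g.2.2 hφ)

instance : CompleteSpace (HFun L) := by
  refine Metric.complete_of_cauchySeq_tendsto (α := HFun L) fun u hu => ?_
  have hb : ∀ (f : HFun L) (φ : Dual L), |f.1 φ| ≤ ‖f‖ := fun f φ =>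
    abs_le_fblNorm f.2.2 φ
  have hc := Metric.cauchySeq_iff.1 hu
  have hpt : ∀ φ : Dual L, ∃ a, Filter.Tendsto (fun n => (u n).1 φ) Filter.atTop
      (nhds a) := fun φ => by
    refine cauchySeq_tendsto_of_complete (Metric.cauchySeq_iff.2 fun ε hε => ?_)
    obtain ⟨N, hN⟩ := hc ε hε
    refine ⟨N, fun m hm n hn => lt_of_le_of_lt ?_ (hN m hm n hn)⟩
    rw [Real.dist_eq, dist_eq_norm]
    exact hb (u m - u n) φ
  choose f hf using hpt
  have hclose : ∀ ε > 0, ∃ N, ∀ n ≥ N, ∀ (m : ℕ) (φ : Fin m → Dual L),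
      (∀ x, ∑ i, |(φ i x : ℝ)| ≤ 1) → ∑ i, |((u n).1 - f) (φ i)| ≤ ε := by
    intro ε hε
    obtain ⟨N, hN⟩ := hc ε hε
    refine ⟨N, fun n hn m φ hφ => ?_⟩
    have ht : Filter.Tendsto
        (fun k => ∑ i, |(u n).1 (φ i) - (u k).1 (φ i)|) Filter.atTop
        (nhds (∑ i, |(u n).1 (φ i) - f (φ i)|)) :=
      tendsto_finsetSum _ fun i _ => (tendsto_const_nhds.sub (hf (φ i))).abs
    refine le_of_tendsto ht (Filter.eventually_atTop.2 ⟨N, fun k hk => ?_⟩)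
    have h1 := hN n hn k hk
    rw [dist_eq_norm] at h1
    exact (sum_le_fblNorm (u n - u k).2.2 hφ).trans h1.le
  have hmem : f ∈ HSub L := by
    refine ⟨fun φ ψ c hc h => ?_, ?_⟩
    · have h1 := (hf φ).const_mul c
      refine tendsto_nhds_unique (hf ψ) (h1.congr fun n => ?_)
      exact ((u n).2.1 φ ψ c hc h).symm
    · obtain ⟨N, hN⟩ := hclose 1 one_pos
      have hd : BddAbove (normSums ((u N).1 - f)) :=
        bddAbove_normSums fun m φ hφ => hN N le_rfl m φ hφ
      refine bddAbove_normSums (C := fblNorm (u N).1 +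
        |(-1 : ℝ)| * fblNorm ((u N).1 - f)) fun m φ hφ => ?_
      have h1 := sum_le_fblNorm (u N).2.2 hφ
      have h2 := sum_smul_le hd (-1) hφ
      refine le_trans ?_ (add_le_add h1 h2)
      rw [← Finset.sum_add_distrib]
      refine Finset.sum_le_sum fun i _ => ?_
      have h3 : f (φ i) = (u N).1 (φ i) +
          ((-1 : ℝ) • ((u N).1 - f)) (φ i) := by simp
      conv_lhs => rw [h3]
      exact abs_add_le _ _
  let F : HFun L := ⟨f, hmem⟩
  refine ⟨F, Metric.tendsto_atTop.2 fun ε hε => ?_⟩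
  obtain ⟨N, hN⟩ := hclose (ε / 2) (half_pos hε)
  refine ⟨N, fun n hn => ?_⟩
  rw [dist_eq_norm]
  exact lt_of_le_of_lt (fblNorm_le fun m φ hφ => hN n hn m φ hφ) (half_lt_self hε)

/-- The evaluation `δ_x : L^* → ℝ`. -/
def eval (x : L) : HFun L :=
  ⟨fun φ => (φ x : ℝ), fun _ _ _ _ h => h x, bddAbove_normSums fun _ _ hφ => hφ x⟩

/-- A vector sublattice of `HFun L`. -/
def IsVectorSublattice (S : Submodule ℝ (HFun L)) : Prop :=
  ∀ f ∈ S, ∀ g ∈ S, f ⊔ g ∈ S ∧ f ⊓ g ∈ S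

variable (L)

/-- The concrete free Banach lattice `FBL⟨L⟩`: the smallest norm closed vector sublattice of
`HFun L` that contains all evaluations `δ_x`. -/
noncomputable def FBL : Submodule ℝ (HFun L) :=
  sInf {S | IsVectorSublattice S ∧ IsClosed (S : Set (HFun L)) ∧ ∀ x : L, eval x ∈ S}

variable {L}

theorem FBL.isVectorSublattice : IsVectorSublattice (FBL L) := by
  intro f hf g hg
  simp only [FBL, Submodule.mem_sInf] at hf hg ⊢
  exact ⟨fun S hS => (hS.1 f (hf S hS) g (hg S hS)).1,
    fun S hS => (hS.1 f (hf S hS) g (hg S hS)).2⟩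

theorem FBL.eval_mem (x : L) : eval x ∈ FBL L := by
  simp only [FBL, Submodule.mem_sInf]
  exact fun S hS => hS.2.2 x

theorem FBL.isClosed : IsClosed (FBL L : Set (HFun L)) := by
  rw [FBL, Submodule.coe_sInf]
  exact isClosed_biInter fun S hS => hS.2.1

noncomputable instance : Lattice (FBL L) :=
  Subtype.lattice (fun _ _ hf hg => (FBL.isVectorSublattice _ hf _ hg).1)
    (fun _ _ hf hg => (FBL.isVectorSublattice _ hf _ hg).2)

instance : CompleteSpace (FBL L) := FBL.isClosed.completeSpace_coe

instance : IsOrderedAddMonoid (FBL L) where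
  add_le_add_left f g h c := by
    have h' : (f : HFun L) ≤ g := h
    exact (add_le_add_left h' (c : HFun L) : (f : HFun L) + c ≤ (g : HFun L) + c)

instance : IsOrderedModule ℝ (FBL L) where
  smul_le_smul_of_nonneg_left c hc f g h := by
    have h' : (f : HFun L) ≤ g := h
    exact (smul_le_smul_of_nonneg_left h' hc : c • (f : HFun L) ≤ c • (g : HFun L))
  smul_le_smul_of_nonneg_right f hf c d h := by
    have hf' : (0 : HFun L) ≤ f := hf
    exact (smul_le_smul_of_nonneg_right h hf' : c • (f : HFun L) ≤ d • (f : HFun L))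

instance : HasSolidNorm (FBL L) where
  solid {f g} h := by
    have h' : |(f : HFun L)| ≤ |(g : HFun L)| := h
    exact (norm_le_norm_of_abs_le_abs h' : ‖(f : HFun L)‖ ≤ ‖(g : HFun L)‖)

/-- The canonical lattice homomorphism `x ↦ δ_x` from `L` to `FBL⟨L⟩`. -/
noncomputable def FBL.delta : LatticeHom L (FBL L) where
  toFun x := ⟨eval x, FBL.eval_mem x⟩
  map_sup' x y := Subtype.ext (Subtype.ext (funext fun φ => congrArg Subtype.val (map_sup φ x y)))
  map_inf' x y := Subtype.ext (Subtype.ext (funext fun φ => congrArg Subtype.val (map_inf φ x y)))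

end Construction

end FreeBL

/-! Everything rests on pointwise continuous paths `p t` of real-valued Banach lattice
homomorphisms, and on two properties of `δ`: paths in `L^*` extend to such paths (`ExtendsPaths`),
and a real-valued homomorphism is determined on `L` (`DeterminesHoms`).

Order completeness and order continuity. A prime ideal separating two points gives `χ : L → {0, 1}`.
Along the path `(χ + t) / 2` some elements satisfy `p t u = t` and `p t e = 1` for `|t| ≤ 1`, so
they look like the functions `t` and `1` on `[-1, 1]`. The increasing sequence `(n u⁺) ∧ e` then
tends to the discontinuous indicator of `t > 0`. A supremum would be at least `1` at `0` by limits
from the right and at most `0` by limits from the left. Likewise the differences between upper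
bounds of the sequence and its terms have infimum `0`, but all have value at least `1` at `0`, so
their norms stay away from `0`.

Atoms. The coefficient along an atom `a` is a homomorphism `h` with `h a = 1`, and a small multiple
of `h` restricts to a point of `L^*`. That point is not isolated, even up to scaling, so an element
positive on `a` at nearby parameters can be cut down to one that is not a multiple of `a`.

The two properties hold in the concrete model by closed-sublattice arguments, and in the abstract
case by testing the universal property on spaces of bounded continuous functions. -/

namespace FreeBL

open Filter Topology
open scoped BoundedContinuousFunction

/-! ### Disjointness and truncations in vector lattices -/

section VectorLattice

theorem inf_eq_zero_of_le {X : Type*} [Zero X] [Lattice X] {a b c : X} (ha : 0 ≤ a) (hc : 0 ≤ c) (hab : a ≤ b)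
    (h : b ⊓ c = 0) : a ⊓ c = 0 :=
  le_antisymm (h ▸ inf_le_inf_right c hab) (le_inf ha hc)

variable {X : Type*} [AddCommGroup X] [Lattice X] [IsOrderedAddMonoid X]

/-- Since `-(a ⊓ c) = -a ⊔ -c`, the difference of `(a + b) ⊓ c` and `a ⊓ c` is the larger of two
elements, each of which is below both `b` and `c`. -/
theorem add_inf_le_inf_add_inf {a b c : X} (ha : 0 ≤ a) (hb : 0 ≤ b) (hc : 0 ≤ c) :
    (a + b) ⊓ c ≤ a ⊓ c + b ⊓ c := by
  have h1 : (a + b) ⊓ c - a ⊓ c ≤ b ⊓ c := by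
    rw [sub_eq_add_neg, neg_inf, add_sup]
    refine sup_le (le_inf ?_ ?_) ?_
    · rw [← sub_eq_add_neg, sub_le_iff_le_add']
      exact inf_le_left
    · rw [← sub_eq_add_neg, sub_le_iff_le_add]
      exact inf_le_right.trans (le_add_of_nonneg_right ha)
    · rw [← sub_eq_add_neg]
      exact (sub_nonpos.2 inf_le_right).trans (le_inf hb hc)
  exact sub_le_iff_le_add'.1 h1

theorem add_inf_eq_zero {a b c : X} (ha : 0 ≤ a) (hb : 0 ≤ b) (hc : 0 ≤ c)
    (hac : a ⊓ c = 0) (hbc : b ⊓ c = 0) : (a + b) ⊓ c = 0 := by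
  refine le_antisymm ?_ (le_inf (add_nonneg ha hb) hc)
  simpa [hac, hbc] using add_inf_le_inf_add_inf ha hb hc

theorem nsmul_inf_eq_zero {a c : X} (ha : 0 ≤ a) (hc : 0 ≤ c) (hac : a ⊓ c = 0) (n : ℕ) :
    (n • a) ⊓ c = 0 := by
  induction n with
  | zero => simpa using hc
  | succ n ih => rw [succ_nsmul]; exact add_inf_eq_zero (nsmul_nonneg ha n) ha hc ih hac

theorem abs_sup_sub_sup_le_add (x y p q : X) : |x ⊔ y - p ⊔ q| ≤ |x - p| + |y - q| := by
  have key : ∀ x y p q : X, x ⊔ y - p ⊔ q ≤ |x - p| + |y - q| := by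
    intro x y p q
    rw [sub_le_iff_le_add]
    refine sup_le ?_ ?_
    · have h1 : x ≤ |x - p| + p := sub_le_iff_le_add.1 (le_abs_self _)
      exact h1.trans (add_le_add (le_add_of_nonneg_right (abs_nonneg _)) le_sup_left)
    · have h1 : y ≤ |y - q| + q := sub_le_iff_le_add.1 (le_abs_self _)
      exact h1.trans (add_le_add (le_add_of_nonneg_left (abs_nonneg _)) le_sup_right)
  refine abs_le'.2 ⟨key x y p q, ?_⟩
  rw [neg_sub, abs_sub_comm x, abs_sub_comm y]
  exact key p q x y

theorem abs_add_inf_eq_zero {y z a : X} (ha : 0 ≤ a) (hy : |y| ⊓ a = 0) (hz : |z| ⊓ a = 0) :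
    |y + z| ⊓ a = 0 :=
  inf_eq_zero_of_le (abs_nonneg _) ha (abs_add_le y z)
    (add_inf_eq_zero (abs_nonneg y) (abs_nonneg z) ha hy hz)

/-- The truncations `(n u⁺) ∧ e`. -/
def truncation (u e : X) (n : ℕ) : X := (n • u⁺) ⊓ e

theorem truncation_monotone (u e : X) : Monotone (truncation u e) := fun _ _ hmn =>
  inf_le_inf_right e (nsmul_le_nsmul_left (posPart_nonneg u) hmn)

theorem truncation_le {X : Type*} [AddCommGroup X] [Lattice X] (u e : X) (n : ℕ) : truncation u e n ≤ e := inf_le_right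

theorem truncation_nonneg (u : X) {e : X} (he : 0 ≤ e) (n : ℕ) : 0 ≤ truncation u e n :=
  le_inf (nsmul_nonneg (posPart_nonneg u) n) he

/-- The parts `u⁺` and `u⁻` are disjoint, hence so are the two truncations; the sum of disjoint
elements is their supremum, which stays below `e`. This yields upper bounds for the truncations that
vanish where `u` is negative enough. -/
theorem truncation_le_sub (u : X) {e : X} (he : 0 ≤ e) (m n : ℕ) :
    truncation u e n ≤ e - truncation (-u) e m := by
  have h0 : (n • u⁺) ⊓ (m • u⁻) = 0 := by
    refine nsmul_inf_eq_zero (posPart_nonneg u) (nsmul_nonneg (negPart_nonneg u) m) ?_ n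
    rw [inf_comm]
    refine nsmul_inf_eq_zero (negPart_nonneg u) (posPart_nonneg u) ?_ m
    rw [inf_comm]
    exact posPart_inf_negPart_eq_zero u
  have h1 : truncation u e n ⊓ truncation (-u) e m = 0 := by
    refine le_antisymm ?_ (le_inf (truncation_nonneg u he n) (truncation_nonneg (-u) he m))
    rw [← h0]
    refine inf_le_inf inf_le_left ?_
    rw [truncation, posPart_neg]
    exact inf_le_left
  have h2 := inf_add_sup (truncation u e n) (truncation (-u) e m)
  rw [h1, zero_add] at h2
  rw [le_sub_iff_add_le, ← h2]
  exact sup_le inf_le_right inf_le_right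

variable [Module ℝ X] [IsOrderedModule ℝ X]

theorem abs_smul_le {X : Type*} [AddCommGroup X] [Lattice X] [Module ℝ X] [IsOrderedModule ℝ X]
    (c : ℝ) (y : X) : |c • y| ≤ |c| • |y| := by
  have key : ∀ y : X, c • y ≤ |c| • |y| := by
    intro y
    rcases le_total 0 c with h | h
    · rw [abs_of_nonneg h]
      exact smul_le_smul_of_nonneg_left (le_abs_self y) h
    · rw [abs_of_nonpos h, ← neg_smul_neg]
      exact smul_le_smul_of_nonneg_left (neg_le_abs y) (neg_nonneg.2 h)
  refine abs_le'.2 ⟨key y, ?_⟩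
  simpa using key (-y)

theorem abs_smul_le_nsmul (c : ℝ) (y : X) : ∃ n : ℕ, |c • y| ≤ n • |y| := by
  obtain ⟨n, hn⟩ := exists_nat_ge |c|
  refine ⟨n, (abs_smul_le c y).trans ?_⟩
  rw [← Nat.cast_smul_eq_nsmul ℝ]
  exact smul_le_smul_of_nonneg_right hn (abs_nonneg y)

theorem abs_smul_inf_eq_zero {y a : X} (ha : 0 ≤ a) (h : |y| ⊓ a = 0) (c : ℝ) :
    |c • y| ⊓ a = 0 := by
  obtain ⟨n, hn⟩ := abs_smul_le_nsmul c y
  exact inf_eq_zero_of_le (abs_nonneg _) ha hn (nsmul_inf_eq_zero (abs_nonneg y) ha h n)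

theorem smul_sup_smul {a : X} (ha : 0 ≤ a) (r s : ℝ) : (r ⊔ s) • a = r • a ⊔ s • a := by
  rcases le_total r s with h | h
  · rw [sup_eq_right.2 h, sup_eq_right.2 (smul_le_smul_of_nonneg_right h ha)]
  · rw [sup_eq_left.2 h, sup_eq_left.2 (smul_le_smul_of_nonneg_right h ha)]

theorem eq_zero_of_abs_smul_inf_eq_zero {a : X} (ha : 0 < a) {c : ℝ}
    (h : |c • a| ⊓ a = 0) : c = 0 := by
  by_contra hc
  have h1 := abs_smul_inf_eq_zero ha.le h c⁻¹
  rw [inv_smul_smul₀ hc, abs_of_nonneg ha.le, inf_idem] at h1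
  exact ha.ne' h1

end VectorLattice

/-! ### The coordinate functional of an atom -/

section Atom

theorem IsBanachLatticeHom.of_sup {X : Type*} [NormedAddCommGroup X]
    [NormedSpace ℝ X] [Lattice X] [IsOrderedAddMonoid X] {Y : Type*} [NormedAddCommGroup Y] [NormedSpace ℝ Y] [Lattice Y]
    [IsOrderedAddMonoid Y] {T : X →L[ℝ] Y} (h : ∀ f g, T (f ⊔ g) = T f ⊔ T g) :
    IsBanachLatticeHom T := by
  refine fun f g => ⟨h f g, ?_⟩
  have h1 := congrArg T (inf_add_sup f g)
  rw [map_add, map_add, h, ← inf_add_sup (T f) (T g)] at h1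
  exact add_right_cancel h1

variable {X : Type*} [NormedAddCommGroup X] [NormedSpace ℝ X] [Lattice X]
  [IsOrderedAddMonoid X] [IsOrderedModule ℝ X] [HasSolidNorm X]

theorem IsVectorAtom.exists_disjoint_of_nonneg {a : X} (ha : IsVectorAtom a) {x : X}
    (hx : 0 ≤ x) : ∃ r : ℝ, |x - r • a| ⊓ a = 0 := by
  have ha0 : 0 ≤ a := ha.1.le
  have hna : 0 < ‖a‖ := norm_pos_iff.2 ha.1.ne'
  -- This makes `‖c • a‖ = ‖x‖ + ‖a‖ > ‖x‖`, so `c • a ≤ x` fails. Hence `r < c` below, and the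
  -- disjointness of `(c - r) • a` and `x - r • a` rescales to `a`.
  set c : ℝ := ‖x‖ / ‖a‖ + 1 with hc
  have hc0 : 0 < c := by positivity
  obtain ⟨r', hr'⟩ := ha.2 (c⁻¹ • (x ⊓ c • a))
    (smul_nonneg (inv_nonneg.2 hc0.le) (le_inf hx (smul_nonneg hc0.le ha0))) (by
      have := smul_le_smul_of_nonneg_left (inf_le_right : x ⊓ c • a ≤ c • a)
        (inv_nonneg.2 hc0.le)
      rwa [inv_smul_smul₀ hc0.ne'] at this)
  have hr : x ⊓ c • a = (c * r') • a := by
    rw [mul_smul, ← hr', smul_inv_smul₀ hc0.ne']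
  set r := c * r'
  have hrx : r • a ≤ x := hr ▸ inf_le_left
  have hrc : r < c := by
    by_contra! h
    have h1 : c • a ≤ x := (smul_le_smul_of_nonneg_right h ha0).trans hrx
    have h2 : ‖c • a‖ ≤ ‖x‖ := norm_le_norm_of_abs_le_abs (by
      rwa [abs_of_nonneg hx, abs_of_nonneg (smul_nonneg hc0.le ha0)])
    rw [norm_smul, Real.norm_of_nonneg hc0.le, hc, add_mul, div_mul_cancel₀ _ hna.ne'] at h2
    linarith
  have h0 : ((c - r) • a) ⊓ (x - r • a) = 0 := by
    rw [sub_smul, ← inf_sub, inf_comm, hr, sub_self]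
  refine ⟨r, ?_⟩
  rw [abs_of_nonneg (sub_nonneg.2 hrx), inf_comm]
  have hcr : 0 < c - r := sub_pos.2 hrc
  have hb : 0 ≤ (c - r) • a := smul_nonneg hcr.le ha0
  have h1 := abs_smul_inf_eq_zero (sub_nonneg.2 hrx) (by rwa [abs_of_nonneg hb]) (c - r)⁻¹
  rwa [inv_smul_smul₀ hcr.ne', abs_of_nonneg ha0] at h1

theorem IsVectorAtom.exists_disjoint {a : X} (ha : IsVectorAtom a) (x : X) :
    ∃ r : ℝ, |x - r • a| ⊓ a = 0 := by
  obtain ⟨r, hr⟩ := ha.exists_disjoint_of_nonneg (posPart_nonneg x)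
  obtain ⟨s, hs⟩ := ha.exists_disjoint_of_nonneg (negPart_nonneg x)
  refine ⟨r - s, ?_⟩
  have h1 := abs_add_inf_eq_zero ha.1.le hr (abs_smul_inf_eq_zero ha.1.le hs (-1))
  have h2 : x⁺ - r • a + (-1 : ℝ) • (x⁻ - s • a) = x - (r - s) • a := by
    conv_rhs => rw [← posPart_sub_negPart x]
    module
  rwa [h2] at h1

/-- An atom of a Banach lattice is the support of a real-valued Banach lattice homomorphism. -/
theorem IsVectorAtom.exists_hom {a : X} (ha : IsVectorAtom a) :
    ∃ h : X →L[ℝ] ℝ, IsBanachLatticeHom h ∧ h a = 1 := by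
  have ha0 : 0 ≤ a := ha.1.le
  choose r hr using ha.exists_disjoint
  -- Uniqueness of the coefficient reduces linearity and preservation of suprema to disjointness of
  -- a remainder from `a`.
  have huniq : ∀ x s, |x - s • a| ⊓ a = 0 → r x = s := by
    intro x s hs
    have h1 := abs_add_inf_eq_zero ha0 hs (abs_smul_inf_eq_zero ha0 (hr x) (-1))
    have h2 : x - s • a + (-1 : ℝ) • (x - r x • a) = (r x - s) • a := by module
    rw [h2] at h1
    exact sub_eq_zero.1 (eq_zero_of_abs_smul_inf_eq_zero ha.1 h1)
  have hadd : ∀ x y, r (x + y) = r x + r y := fun x y => huniq _ _ (by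
    have := abs_add_inf_eq_zero ha0 (hr x) (hr y)
    rwa [show x - r x • a + (y - r y • a) = x + y - (r x + r y) • a by module] at this)
  have hsmul : ∀ (c : ℝ) x, r (c • x) = c • r x := fun c x => huniq _ _ (by
    have := abs_smul_inf_eq_zero ha0 (hr x) c
    rwa [show c • (x - r x • a) = c • x - (c • r x) • a by module] at this)
  have hbound : ∀ x, ‖r x‖ ≤ ‖a‖⁻¹ * ‖x‖ := by
    intro x
    have h1 : |r x • a| ⊓ |x - r x • a| = 0 :=
      abs_smul_inf_eq_zero (abs_nonneg _) (by rw [abs_of_nonneg ha0, inf_comm]; exact hr x) _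
    have h2 : |r x • a| ≤ |x| + |x - r x • a| := by
      calc |r x • a| = |x - (x - r x • a)| := by rw [sub_sub_cancel]
        _ ≤ |x| + |x - r x • a| := by
          rw [sub_eq_add_neg, ← abs_neg (x - r x • a)]
          exact abs_add_le _ _
    -- `|r x • a|` lies below a sum and is disjoint from the second summand, so it lies below the
    -- first.
    have h3 : |r x • a| ≤ |x| := by
      have := add_inf_le_inf_add_inf (abs_nonneg x) (abs_nonneg (x - r x • a))
        (abs_nonneg (r x • a))
      rw [inf_eq_right.2 h2, inf_comm |x - r x • a|, h1, add_zero] at this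
      exact this.trans inf_le_left
    have h4 := norm_le_norm_of_abs_le_abs h3
    rw [norm_smul] at h4
    rw [← div_eq_inv_mul, le_div_iff₀ (norm_pos_iff.2 ha.1.ne')]
    exact h4
  refine ⟨LinearMap.mkContinuous ⟨⟨r, hadd⟩, hsmul⟩ ‖a‖⁻¹ hbound,
    IsBanachLatticeHom.of_sup fun x y => huniq _ _ ?_, huniq _ _ (by simpa using ha0)⟩
  change |x ⊔ y - (r x ⊔ r y) • a| ⊓ a = 0
  refine inf_eq_zero_of_le (abs_nonneg _) ha0 ?_
    (add_inf_eq_zero (abs_nonneg _) (abs_nonneg _) ha0 (hr x) (hr y))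
  rw [smul_sup_smul ha0]
  exact abs_sup_sub_sup_le_add _ _ _ _

end Atom

/-! ### A path through a sign change obstructs order completeness and order continuity -/

section Path

variable {X : Type*} [NormedAddCommGroup X] [NormedSpace ℝ X] [Lattice X]

theorem IsBanachLatticeHom.monotone {T : X →L[ℝ] ℝ} (h : IsBanachLatticeHom T) :
    Monotone T := fun f g hfg => by
  rw [← sup_eq_right.2 hfg, (h f g).1]
  exact le_sup_left

theorem IsBanachLatticeHom.map_posPart {T : X →L[ℝ] ℝ} (h : IsBanachLatticeHom T) (f : X) :
    T f⁺ = max (T f) 0 := by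
  rw [posPart_def, (h _ _).1, map_zero]

theorem IsBanachLatticeHom.map_truncation {T : X →L[ℝ] ℝ} (h : IsBanachLatticeHom T) (u e : X)
    (n : ℕ) : T (truncation u e n) = min (n * max (T u) 0) (T e) := by
  rw [truncation, (h _ _).2, map_nsmul, h.map_posPart, nsmul_eq_mul]

theorem one_le_of_truncation_le {T : X →L[ℝ] ℝ} (h : IsBanachLatticeHom T) {u e w : X}
    (hu : 0 < T u) (he : T e = 1) (hw : ∀ n, truncation u e n ≤ w) : 1 ≤ T w := by
  obtain ⟨n, hn⟩ := exists_nat_ge (1 / T u)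
  have h1 := h.monotone (hw n)
  rw [h.map_truncation, he, max_eq_left hu.le, min_eq_right] at h1
  · exact h1
  · rwa [div_le_iff₀ hu] at hn

variable {p : ℝ → X →L[ℝ] ℝ} (hp : ∀ t, IsBanachLatticeHom (p t))
  (hc : ∀ f, Continuous fun t => p t f) {u e : X} (he0 : 0 ≤ e)
  (hu : ∀ t, |t| ≤ 1 → p t u = t) (he : ∀ t, |t| ≤ 1 → p t e = 1)

include hp hc hu he

/-- For `t > 0` the truncations reach the value `1` at `p t` once `n * t ≥ 1`; continuity carries
the bound to `t = 0`, where the truncations themselves vanish. -/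
theorem one_le_of_upperBound_truncation {w : X} (hw : ∀ n, truncation u e n ≤ w) :
    1 ≤ p 0 w := by
  have h1 : Tendsto (fun t => p t w) (𝓝[>] 0) (𝓝 (p 0 w)) :=
    (hc w).continuousAt.tendsto.mono_left nhdsWithin_le_nhds
  refine ge_of_tendsto h1 ?_
  filter_upwards [Ioc_mem_nhdsGT (zero_lt_one (α := ℝ))] with t ht
  have ht1 : |t| ≤ 1 := by rw [abs_of_pos ht.1]; exact ht.2
  exact one_le_of_truncation_le (hp t) (by rw [hu t ht1]; exact ht.1) (he t ht1) hw

variable [IsOrderedAddMonoid X]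

include he0

theorem not_dedekindSigmaComplete_of_path : ¬ DedekindSigmaComplete X := by
  intro hX
  obtain ⟨s, hs⟩ := hX (Set.range (truncation u e)) (Set.range_nonempty _)
    (Set.countable_range _) ⟨e, by rintro _ ⟨n, rfl⟩; exact truncation_le u e n⟩
  have h1 : 1 ≤ p 0 s := one_le_of_upperBound_truncation hp hc hu he fun n => hs.1 ⟨n, rfl⟩
  -- Each `e - truncation (-u) e m` is an upper bound, so the least one lies below it. The argument
  -- from the right now applies to `e - s` for `t < 0`.
  have h2 : ∀ m, truncation (-u) e m ≤ e - s := fun m => le_sub_comm.1 <| hs.2 <| by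
    rintro _ ⟨n, rfl⟩
    exact truncation_le_sub u he0 m n
  have h3 : p 0 s ≤ 0 := by
    have h1 : Tendsto (fun t => p t s) (𝓝[<] 0) (𝓝 (p 0 s)) :=
      (hc s).continuousAt.tendsto.mono_left nhdsWithin_le_nhds
    refine le_of_tendsto h1 ?_
    filter_upwards [Ico_mem_nhdsLT (neg_one_lt_zero (R := ℝ))] with t ht
    have ht1 : |t| ≤ 1 := by rw [abs_of_neg ht.2]; linarith [ht.1]
    have := one_le_of_truncation_le (hp t) (by rw [map_neg, hu t ht1]; linarith [ht.2])
      (he t ht1) h2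
    rw [map_sub, he t ht1] at this
    linarith
  linarith

variable [IsOrderedModule ℝ X] [HasSolidNorm X]

theorem not_orderContinuousNorm_of_path : ¬ OrderContinuousNorm X := by
  intro hX
  set U : Set X := upperBounds (Set.range (truncation u e)) with hU
  have hUmem : ∀ w, w ∈ U ↔ ∀ n, truncation u e n ≤ w := fun w => by
    simp [hU, upperBounds]
  have heU : e ∈ U := (hUmem e).2 (truncation_le u e)
  -- A lower bound `z` of the differences can be subtracted from any upper bound of the truncations
  -- to give another one. Starting from `e`, this gives `k • z ≤ e` for all `k`, hence `z ≤ 0`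
  -- because the positive cone is closed.
  have hglb : IsGLB (Set.image2 (fun w n => w - truncation u e n) U Set.univ) 0 := by
    constructor
    · rintro _ ⟨w, hw, n, -, rfl⟩
      exact sub_nonneg.2 ((hUmem w).1 hw n)
    · intro z hz
      have hstep : ∀ w ∈ U, w - z ∈ U := fun w hw => (hUmem _).2 fun n =>
        le_sub_comm.1 (hz ⟨w, hw, n, trivial, rfl⟩)
      have hk : ∀ k : ℕ, e - k • z ∈ U := by
        intro k
        induction k with
        | zero => simpa using heU
        | succ k ih =>
          rw [succ_nsmul, ← sub_sub]
          exact hstep _ ih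
      have hle : ∀ k : ℕ, z ≤ ((k : ℝ) + 1)⁻¹ • e := by
        intro k
        have h1 : (k + 1) • z ≤ e := sub_nonneg.1
          ((truncation_nonneg u he0 0).trans ((hUmem _).1 (hk (k + 1)) 0))
        have h2 : (0 : ℝ) < (k : ℝ) + 1 := by positivity
        have h3 := smul_le_smul_of_nonneg_left h1 (inv_nonneg.2 h2.le)
        rwa [← Nat.cast_smul_eq_nsmul ℝ, Nat.cast_succ, inv_smul_smul₀ h2.ne'] at h3
      have hlim : Tendsto (fun k : ℕ => ((k : ℝ) + 1)⁻¹ • e) atTop (𝓝 0) := by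
        have := (tendsto_one_div_add_atTop_nhds_zero_nat (𝕜 := ℝ)).smul_const e
        simpa using this
      exact ge_of_tendsto' hlim hle
  have hdir : DirectedOn (fun a b => b ≤ a)
      (Set.image2 (fun w n => w - truncation u e n) U Set.univ) := by
    rintro _ ⟨w, hw, m, -, rfl⟩ _ ⟨w', hw', n, -, rfl⟩
    refine ⟨_, ⟨w ⊓ w', (hUmem _).2 fun k => le_inf ((hUmem w).1 hw k) ((hUmem w').1 hw' k),
      max m n, trivial, rfl⟩, ?_, ?_⟩
    · exact sub_le_sub inf_le_left (truncation_monotone u e (le_max_left m n))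
    · exact sub_le_sub inf_le_right (truncation_monotone u e (le_max_right m n))
  obtain ⟨_, ⟨w, hw, n, -, rfl⟩, h⟩ := hX _
    (Set.Nonempty.image2 ⟨e, heU⟩ Set.univ_nonempty) hdir hglb
    (‖p 0‖ + 1)⁻¹ (by positivity)
  have h1 := h _ ⟨w, hw, n, trivial, rfl⟩ le_rfl
  have h2 : 1 ≤ p 0 w := one_le_of_upperBound_truncation hp hc hu he ((hUmem w).1 hw)
  have h3 : p 0 (truncation u e n) = 0 := by
    rw [(hp 0).map_truncation, hu 0 (by simp), he 0 (by simp)]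
    simp
  have h4 := (p 0).le_opNorm (w - truncation u e n)
  rw [map_sub, h3, sub_zero] at h4
  have h5 : 1 ≤ ‖p 0‖ * ‖w - truncation u e n‖ := (h2.trans (le_abs_self _)).trans h4
  have h6 : 0 < ‖p 0‖ + 1 := by positivity
  rw [← one_div, lt_div_iff₀ h6] at h1
  nlinarith [norm_nonneg (w - truncation u e n)]

end Path

/-! ### Points of the dual and separation by prime ideals -/

section Dual

variable {L : Type u} [Lattice L]

/-- The element `a g + b` of `L^*`, for a real-valued lattice homomorphism `g` and `a ≥ 0`. -/
def affineDual (g : LatticeHom L ℝ) (a b : ℝ) (ha : 0 ≤ a) (h : ∀ z, |a * g z + b| ≤ 1) :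
    Dual L where
  toFun z := ⟨a * g z + b, abs_le.1 (h z)⟩
  map_sup' x y := Subtype.ext <| by
    change a * g (x ⊔ y) + b = (a * g x + b) ⊔ (a * g y + b)
    rw [SupHomClass.map_sup, mul_max_of_nonneg _ _ ha, max_add_add_right]
  map_inf' x y := Subtype.ext <| by
    change a * g (x ⊓ y) + b = (a * g x + b) ⊓ (a * g y + b)
    rw [InfHomClass.map_inf, mul_min_of_nonneg _ _ ha, min_add_add_right]

/-- The real-valued lattice homomorphism underlying an element of `L^*`. -/
def Dual.toReal (φ : Dual L) : LatticeHom L ℝ where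
  toFun z := φ z
  map_sup' x y := congrArg Subtype.val (map_sup φ x y)
  map_inf' x y := congrArg Subtype.val (map_inf φ x y)

theorem Dual.abs_le_one (φ : Dual L) (x : L) : |(φ x : ℝ)| ≤ 1 := abs_le.2 (φ x).2

theorem abs_convex_le_one {s b c : ℝ} (hs0 : 0 ≤ s) (hs1 : s ≤ 1) (hb : |b| ≤ 1) (hc : |c| ≤ 1) :
    |(1 - s) * b + s * c| ≤ 1 := by
  rw [abs_le] at *
  constructor <;> nlinarith

/-- The indicator function of the complement of a prime ideal. -/
theorem exists_separating_hom {L : Type u} [DistribLattice L] (hL : 2 ≤ Cardinal.mk L) :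
    ∃ (χ : LatticeHom L ℝ) (x y : L), (∀ z, 0 ≤ χ z ∧ χ z ≤ 1) ∧ χ x = 0 ∧ χ y = 1 := by
  classical
  have h1 : ∃ x y : L, ¬ y ≤ x := by
    obtain ⟨x, y, hxy⟩ := (Cardinal.two_le_iff (α := L)).1 hL
    by_contra! h
    exact hxy (le_antisymm (h y x) (h x y))
  obtain ⟨x, y, hxy⟩ := h1
  have hd : Disjoint (Order.PFilter.principal y : Set L) (Order.Ideal.principal x : Set L) := by
    rw [Set.disjoint_left]
    intro z hy hx
    exact hxy ((Order.PFilter.mem_principal.1 hy).trans (Order.Ideal.mem_principal.1 hx))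
  -- Distributivity enters here, through the prime ideal theorem.
  obtain ⟨J, hJ, hIJ, hFJ⟩ := DistribLattice.prime_ideal_of_disjoint_filter_ideal hd
  have hx : x ∈ J := hIJ (Order.Ideal.mem_principal.2 le_rfl)
  have hy : y ∉ J := fun h => Set.disjoint_left.1 hFJ
    (Order.PFilter.mem_principal.2 (le_refl y)) h
  refine ⟨⟨⟨fun z => if z ∈ J then 0 else 1, fun a b => ?_⟩, fun a b => ?_⟩, x, y,
    fun z => ?_, if_pos hx, if_neg hy⟩
  · by_cases ha : a ∈ J <;> by_cases hb : b ∈ J <;> simp [ha, hb, Order.Ideal.sup_mem_iff]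
  · have : a ⊓ b ∈ J ↔ a ∈ J ∨ b ∈ J := ⟨hJ.mem_or_mem,
      fun h => h.elim (fun h => J.lower inf_le_left h) (fun h => J.lower inf_le_right h)⟩
    by_cases ha : a ∈ J <;> by_cases hb : b ∈ J <;> simp [ha, hb, this]
  · change 0 ≤ (if z ∈ J then (0 : ℝ) else 1) ∧ (if z ∈ J then (0 : ℝ) else 1) ≤ 1
    split_ifs <;> norm_num

end Dual

/-! ### Nonexistence of order properties and atoms from paths -/

section Main

variable {L : Type u} {X : Type*} [Lattice L] [NormedAddCommGroup X] [NormedSpace ℝ X]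
  [Lattice X]

/-- Every pointwise continuous path in `L^*` extends to a pointwise continuous path of real-valued
Banach lattice homomorphisms. -/
def ExtendsPaths (δ : LatticeHom L X) : Prop :=
  ∀ Φ : ℝ → Dual L, (∀ x, Continuous fun t => (Φ t x : ℝ)) →
    ∃ p : ℝ → X →L[ℝ] ℝ, (∀ t, IsBanachLatticeHom (p t)) ∧ (∀ f, Continuous fun t => p t f) ∧
      ∀ t x, p t (δ x) = Φ t x

/-- Real-valued Banach lattice homomorphisms are determined by their restriction to `L`. -/
def DeterminesHoms (δ : LatticeHom L X) : Prop :=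
  ∀ p q : X →L[ℝ] ℝ, IsBanachLatticeHom p → IsBanachLatticeHom q →
    (∀ x, p (δ x) = q (δ x)) → p = q

theorem exists_separating_path {L : Type u} {X : Type*} [DistribLattice L]
    [NormedAddCommGroup X] [NormedSpace ℝ X] [Lattice X] [IsOrderedAddMonoid X]
    [IsOrderedModule ℝ X]
    (hL : 2 ≤ Cardinal.mk L) {δ : LatticeHom L X} (hδ : ExtendsPaths δ) :
    ∃ (p : ℝ → X →L[ℝ] ℝ) (u e : X), (∀ t, IsBanachLatticeHom (p t)) ∧
      (∀ f, Continuous fun t => p t f) ∧ 0 ≤ e ∧ (∀ t, |t| ≤ 1 → p t u = t) ∧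
      ∀ t, |t| ≤ 1 → p t e = 1 := by
  obtain ⟨χ, x, y, hχ, hx, hy⟩ := exists_separating_hom hL
  -- The path is `(χ + t) / 2`, with `t` clamped to `[-1, 1]` so that it stays in `L^*` for every
  -- real `t`.
  obtain ⟨p, hp, hc, hpδ⟩ := hδ (fun t => affineDual χ (1 / 2) (max (-1) (min 1 t) / 2)
    (by norm_num) (fun z => by
      have h1 : -1 ≤ max (-1) (min 1 t) := le_max_left _ _
      have h2 : max (-1) (min 1 t) ≤ 1 := max_le (by norm_num) (min_le_left _ _)
      rw [abs_le]
      constructor <;> linarith [(hχ z).1, (hχ z).2]))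
    (fun z => by
      change Continuous fun t : ℝ => 1 / 2 * χ z + max (-1) (min 1 t) / 2
      fun_prop)
  have hval : ∀ t, |t| ≤ 1 → ∀ z, p t (δ z) = 1 / 2 * χ z + t / 2 := fun t ht z => by
    rw [hpδ]
    change 1 / 2 * χ z + max (-1) (min 1 t) / 2 = _
    rw [min_eq_right (abs_le.1 ht).2, max_eq_right (abs_le.1 ht).1]
  refine ⟨p, (2 : ℝ) • δ x, (2 : ℝ) • (δ y - δ x)⁺, hp, hc,
    smul_nonneg zero_le_two (posPart_nonneg _), fun t ht => ?_, fun t ht => ?_⟩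
  · rw [map_smul, hval t ht, hx, smul_eq_mul]
    ring
  · rw [map_smul, (hp t).map_posPart, map_sub, hval t ht, hval t ht, hx, hy, smul_eq_mul]
    norm_num

/-- Every nonzero element `φ` of `L^*` is the limit along a path of elements not proportional
to `φ`. -/
theorem exists_transversal_path {L : Type u} [DistribLattice L] (hL : 2 ≤ Cardinal.mk L)
    {φ : Dual L} {x₀ : L} (hφ : (φ x₀ : ℝ) ≠ 0) :
    ∃ (Φ : ℝ → Dual L) (x y : L), (∀ x, Continuous fun t => (Φ t x : ℝ)) ∧ Φ 0 = φ ∧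
      ∀ t, 0 < t → t < 1 → (φ x : ℝ) * Φ t y ≠ φ y * Φ t x := by
  have hs0 : ∀ t : ℝ, 0 ≤ max 0 (min 1 t) := fun t => le_max_left _ _
  have hs1 : ∀ t : ℝ, max 0 (min 1 t) ≤ 1 := fun t => max_le (by norm_num) (min_le_left _ _)
  have hst : ∀ t : ℝ, 0 < t → t < 1 → max 0 (min 1 t) = t := fun t h0 h1 => by
    rw [min_eq_right h1.le, max_eq_right h0.le]
  have hs00 : max 0 (min 1 (0 : ℝ)) = 0 := by simp
  -- A constant `φ` moves along the segment to `χ`; any other `φ` moves along the segment to the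
  -- constant `1`. The determinant that tests proportionality is, up to sign, `t * φ x₀` in the
  -- first case and `t * (φ x₀ - φ z₀)` in the second.
  by_cases hconst : ∀ z, (φ z : ℝ) = φ x₀
  · obtain ⟨χ, x, y, hχ, hx, hy⟩ := exists_separating_hom hL
    refine ⟨fun t => affineDual χ (max 0 (min 1 t)) ((1 - max 0 (min 1 t)) * φ x₀) (hs0 t)
      (fun z => ?_), x, y, fun z => ?_, ?_, fun t h0 h1 => ?_⟩
    · rw [add_comm]
      exact abs_convex_le_one (hs0 t) (hs1 t) (φ.abs_le_one x₀)
        (abs_le.2 ⟨by linarith [(hχ z).1], (hχ z).2⟩)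
    · change Continuous fun t : ℝ => max 0 (min 1 t) * χ z + (1 - max 0 (min 1 t)) * (φ x₀ : ℝ)
      fun_prop
    · ext z
      change max 0 (min 1 (0 : ℝ)) * χ z + (1 - max 0 (min 1 (0 : ℝ))) * (φ x₀ : ℝ) = φ z
      rw [hs00, hconst z]
      ring
    · change (φ x : ℝ) * (max 0 (min 1 t) * χ y + (1 - max 0 (min 1 t)) * (φ x₀ : ℝ)) ≠
        φ y * (max 0 (min 1 t) * χ x + (1 - max 0 (min 1 t)) * (φ x₀ : ℝ))
      rw [hst t h0 h1, hconst x, hconst y, hx, hy]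
      intro h
      exact mul_ne_zero hφ h0.ne' (by linarith)
  · push Not at hconst
    obtain ⟨z₀, hz₀⟩ := hconst
    refine ⟨fun t => affineDual φ.toReal (1 - max 0 (min 1 t)) (max 0 (min 1 t))
      (sub_nonneg.2 (hs1 t)) (fun z => ?_), x₀, z₀, fun z => ?_, ?_, fun t h0 h1 => ?_⟩
    · have := abs_convex_le_one (hs0 t) (hs1 t) (φ.abs_le_one z) (c := 1) (by simp)
      rwa [mul_one] at this
    · change Continuous fun t : ℝ => (1 - max 0 (min 1 t)) * (φ z : ℝ) + max 0 (min 1 t)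
      fun_prop
    · ext z
      change (1 - max 0 (min 1 (0 : ℝ))) * (φ z : ℝ) + max 0 (min 1 (0 : ℝ)) = φ z
      rw [hs00]
      ring
    · change (φ x₀ : ℝ) * ((1 - max 0 (min 1 t)) * (φ z₀ : ℝ) + max 0 (min 1 t)) ≠
        φ z₀ * ((1 - max 0 (min 1 t)) * (φ x₀ : ℝ) + max 0 (min 1 t))
      rw [hst t h0 h1]
      intro h
      exact mul_ne_zero (sub_ne_zero.2 hz₀) h0.ne' (by linarith)

theorem not_isVectorAtom_of_extendsPaths {L : Type u} {X : Type*} [DistribLattice L]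
    [NormedAddCommGroup X] [NormedSpace ℝ X] [Lattice X] [IsOrderedAddMonoid X]
    [IsOrderedModule ℝ X] [HasSolidNorm X] (hL : 2 ≤ Cardinal.mk L) {δ : LatticeHom L X}
    (hb : BddAbove (Set.range fun x => ‖δ x‖)) (hδ : ExtendsPaths δ) (hdet : DeterminesHoms δ)
    (a : X) : ¬ IsVectorAtom a := by
  intro ha
  obtain ⟨h, hh, hha⟩ := ha.exists_hom
  obtain ⟨D, hD⟩ := hb
  have hD : ∀ x, ‖δ x‖ ≤ D := fun x => hD ⟨x, rfl⟩
  have hx₀ : ∃ x₀, h (δ x₀) ≠ 0 := by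
    by_contra! h0
    have : h = 0 := hdet h 0 hh (fun f g => by simp) (by simpa using h0)
    simp [this] at hha
  obtain ⟨x₀, hx₀⟩ := hx₀
  have hC : 0 < ‖h‖ * |D| + 1 := by positivity
  -- Scaling by `c` brings the restriction of `h` to `L` into `[-1, 1]`.
  set c : ℝ := (‖h‖ * |D| + 1)⁻¹ with hcdef
  have hc0 : 0 < c := inv_pos.2 hC
  let g : LatticeHom L ℝ :=
    { toFun := fun z => h (δ z)
      map_sup' := fun x y => by rw [SupHomClass.map_sup, (hh _ _).1]
      map_inf' := fun x y => by rw [InfHomClass.map_inf, (hh _ _).2] }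
  let φ : Dual L := affineDual g c 0 hc0.le (fun z => by
    have h1 : |h (δ z)| ≤ ‖h‖ * |D| := (h.le_opNorm _).trans
      (mul_le_mul_of_nonneg_left ((hD z).trans (le_abs_self D)) (norm_nonneg h))
    rw [add_zero, abs_mul, abs_of_pos hc0, hcdef, inv_mul_le_iff₀ hC]
    change |h (δ z)| ≤ _
    linarith)
  have hφ : ∀ z, (φ z : ℝ) = c * h (δ z) := fun z => add_zero _
  obtain ⟨Φ, x, y, hΦc, hΦ0, hΦ⟩ := exists_transversal_path hL (φ := φ) (x₀ := x₀)
    (by rw [hφ]; exact mul_ne_zero hc0.ne' hx₀)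
  obtain ⟨p, hp, hpc, hpδ⟩ := hδ Φ hΦc
  have hp0 : p 0 = c • h := hdet _ _ (hp 0) (IsBanachLatticeHom.of_sup fun f g => by
    change c * h (f ⊔ g) = max (c * h f) (c * h g)
    rw [(hh f g).1, mul_max_of_nonneg _ _ hc0.le]) (fun z => by
      rw [hpδ, hΦ0, hφ]
      rfl)
  have hp0a : 0 < p 0 a := by
    rw [hp0]
    change 0 < c * h a
    rwa [hha, mul_one]
  have hev : ∀ᶠ t in 𝓝[>] (0 : ℝ), 0 < p t a :=
    ((hpc a).continuousAt.eventually (lt_mem_nhds hp0a)).filter_mono nhdsWithin_le_nhds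
  obtain ⟨t, hta, ht0, ht1⟩ :=
    (hev.and (Ioo_mem_nhdsGT (zero_lt_one (α := ℝ)))).exists
  have hne := hΦ t ht0 ht1
  rw [← hΦ0, ← hpδ, ← hpδ, ← hpδ, ← hpδ] at hne
  -- Since `p 0` and `p t` are not proportional on `δ x`, `δ y`, a combination of these two elements
  -- is killed by `p t` but not by `p 0`. Then `f⁺ ⊓ a` vanishes at `p t`, where `a` does not, yet
  -- is positive at `p 0`; no multiple of `a` behaves so.
  obtain ⟨f, hf0, hft⟩ : ∃ f : X, 0 < p 0 f ∧ p t f = 0 := by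
    have h1 : p t ((p t (δ y)) • δ x - (p t (δ x)) • δ y) = 0 := by
      rw [map_sub, map_smul, map_smul, smul_eq_mul, smul_eq_mul]
      ring
    have h2 : p 0 ((p t (δ y)) • δ x - (p t (δ x)) • δ y) ≠ 0 := by
      rw [map_sub, map_smul, map_smul, smul_eq_mul, smul_eq_mul]
      intro h
      exact hne (by linarith)
    rcases lt_or_gt_of_ne h2 with h3 | h3
    · exact ⟨-((p t (δ y)) • δ x - (p t (δ x)) • δ y), by rw [map_neg]; linarith,
        by rw [map_neg, h1, neg_zero]⟩
    · exact ⟨_, h3, h1⟩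
  obtain ⟨r, hr⟩ := ha.2 (f⁺ ⊓ a) (le_inf (posPart_nonneg f) ha.1.le) inf_le_right
  have h1 := congrArg (p t) hr
  rw [(hp t _ _).2, (hp t).map_posPart, hft, max_self, min_eq_left hta.le, map_smul,
    smul_eq_mul] at h1
  have hr0 : r = 0 := (mul_eq_zero.1 h1.symm).resolve_right hta.ne'
  have h2 := congrArg (p 0) hr
  rw [hr0, zero_smul, map_zero, (hp 0 _ _).2, (hp 0).map_posPart, max_eq_left hf0.le] at h2
  exact (lt_min hf0 hp0a).ne' h2

theorem no_order_properties {L : Type u} {X : Type*} [DistribLattice L]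
    [NormedAddCommGroup X] [NormedSpace ℝ X] [Lattice X] [IsOrderedAddMonoid X]
    [IsOrderedModule ℝ X] [HasSolidNorm X] (hL : 2 ≤ Cardinal.mk L) {δ : LatticeHom L X}
    (hb : BddAbove (Set.range fun x => ‖δ x‖)) (hδ : ExtendsPaths δ) (hdet : DeterminesHoms δ) :
    ¬ DedekindSigmaComplete X ∧ ¬ OrderContinuousNorm X ∧ ∀ a : X, ¬ IsVectorAtom a := by
  obtain ⟨p, u, e, hp, hc, he0, hu, he⟩ := exists_separating_path hL hδ
  exact ⟨not_dedekindSigmaComplete_of_path hp hc he0 hu he,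
    not_orderContinuousNorm_of_path hp hc he0 hu he,
    not_isVectorAtom_of_extendsPaths hL hb hδ hdet⟩

end Main

/-! ### The concrete model -/

section Concrete

variable {L : Type u} [Lattice L]

/-- The evaluation of elements of `FBL⟨L⟩` at a point of `L^*`. -/
noncomputable def FBL.evalAt (φ : Dual L) : FBL L →L[ℝ] ℝ :=
  LinearMap.mkContinuous ⟨⟨fun f => f.1.1 φ, fun _ _ => rfl⟩, fun _ _ => rfl⟩ 1 fun f => by
    rw [one_mul]
    exact abs_le_fblNorm f.1.2.2 φ

theorem FBL.evalAt_isBanachLatticeHom (φ : Dual L) : IsBanachLatticeHom (FBL.evalAt φ) :=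
  fun _ _ => ⟨rfl, rfl⟩

/-- A closed vector sublattice of `HFun L` that contains all evaluations contains `FBL⟨L⟩`. -/
theorem FBL.le_of_isClosed {S : Submodule ℝ (HFun L)} (h1 : IsVectorSublattice S)
    (h2 : IsClosed (S : Set (HFun L))) (h3 : ∀ x, eval x ∈ S) : FBL L ≤ S :=
  sInf_le ⟨h1, h2, h3⟩

/-- The functions continuous along `Φ` form a vector sublattice containing the evaluations. It is
closed because the norm dominates the uniform norm. -/
theorem FBL.continuous_path {Φ : ℝ → Dual L} (hΦ : ∀ x, Continuous fun t => (Φ t x : ℝ))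
    (f : FBL L) : Continuous fun t => FBL.evalAt (Φ t) f := by
  let S : Submodule ℝ (HFun L) :=
    { carrier := {f | Continuous fun t => f.1 (Φ t)}
      zero_mem' := (continuous_const : Continuous fun _ : ℝ => (0 : ℝ))
      add_mem' := fun {f g} hf hg => Continuous.add (f := fun t => f.1 (Φ t)) hf hg
      smul_mem' := fun c f hf => Continuous.const_smul (g := fun t => f.1 (Φ t)) hf c }
  refine FBL.le_of_isClosed (S := S) (fun f hf g hg => ⟨?_, ?_⟩) ?_ hΦ f.2
  · exact Continuous.sup (f := fun t => f.1 (Φ t)) hf hg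
  · exact Continuous.inf (f := fun t => f.1 (Φ t)) hf hg
  · refine isClosed_of_closure_subset fun f hf => ?_
    refine continuous_of_uniform_approx_of_continuous (f := fun t => f.1 (Φ t)) fun u hu => ?_
    obtain ⟨ε, hε, hεu⟩ := Metric.mem_uniformity_dist.1 hu
    obtain ⟨g, hg, hfg⟩ := Metric.mem_closure_iff.1 hf ε hε
    refine ⟨fun t => g.1 (Φ t), hg, fun t => hεu ?_⟩
    rw [dist_eq_norm] at hfg
    exact (abs_le_fblNorm (f - g).2.2 (Φ t)).trans_lt hfg

theorem FBL.extendsPaths : ExtendsPaths (FBL.delta (L := L)) := fun Φ hΦ =>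
  ⟨fun t => FBL.evalAt (Φ t), fun t => FBL.evalAt_isBanachLatticeHom (Φ t),
    FBL.continuous_path hΦ, fun _ _ => rfl⟩

/-- The equalizer of two homomorphisms is a closed sublattice containing the generators; it remains
closed in `HFun L` because `FBL L` is closed there. -/
theorem FBL.determinesHoms : DeterminesHoms (FBL.delta (L := L)) := by
  intro p q hp hq h
  let E : Submodule ℝ (FBL L) := (p - q).ker
  have hE : ∀ f, f ∈ E ↔ p f = q f := fun f => by
    rw [LinearMap.mem_ker]
    exact sub_eq_zero
  have hle : FBL L ≤ E.map (FBL L).subtype := by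
    refine FBL.le_of_isClosed ?_ ?_ fun x => ⟨FBL.delta x, (hE _).2 (h x), rfl⟩
    · rintro _ ⟨f, hf, rfl⟩ _ ⟨g, hg, rfl⟩
      have hf' := (hE f).1 hf
      have hg' := (hE g).1 hg
      exact ⟨⟨f ⊔ g, (hE _).2 (by rw [(hp f g).1, (hq f g).1, hf', hg']), rfl⟩,
        ⟨f ⊓ g, (hE _).2 (by rw [(hp f g).2, (hq f g).2, hf', hg']), rfl⟩⟩
    · exact FBL.isClosed.isClosedEmbedding_subtypeVal.isClosedMap _ (p - q).isClosed_ker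
  ext f
  obtain ⟨g, hg, hgf⟩ := hle f.2
  rw [← Subtype.ext hgf]
  exact (hE g).1 hg

theorem FBL.bddAbove_norm_delta : BddAbove (Set.range fun x : L => ‖FBL.delta x‖) :=
  ⟨1, by
    rintro _ ⟨x, rfl⟩
    exact fblNorm_le fun _ _ hφ => hφ x⟩

end Concrete

/-! ### The universal property, tested on function spaces -/

section Pair

variable {X : Type u} [NormedAddCommGroup X] [NormedSpace ℝ X]

/-- The pair of two functionals, as an operator to the functions on a two-point space. -/
noncomputable def pairCLM (p q : X →L[ℝ] ℝ) : X →L[ℝ] (ULift.{u} Bool →ᵇ ℝ) :=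
  LinearMap.mkContinuous
    { toFun := fun f => BoundedContinuousFunction.ofNormedAddCommGroup
        (fun b : ULift.{u} Bool => if b.down then p f else q f) (by fun_prop)
        (max ‖p f‖ ‖q f‖) (fun b => by split_ifs <;> simp)
      map_add' := fun f g => by
        ext ⟨b⟩
        cases b <;> simp
      map_smul' := fun c f => by
        ext ⟨b⟩
        cases b <;> simp }
    (max ‖p‖ ‖q‖) (fun f => by
      refine (BoundedContinuousFunction.norm_le (by positivity)).2 ?_
      rintro ⟨b⟩
      cases b
      · exact (q.le_opNorm f).trans
          (mul_le_mul_of_nonneg_right (le_max_right _ _) (norm_nonneg f))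
      · exact (p.le_opNorm f).trans
          (mul_le_mul_of_nonneg_right (le_max_left _ _) (norm_nonneg f)))

theorem norm_pairCLM {p q : X →L[ℝ] ℝ} (h : ‖p‖ ≤ ‖q‖) : ‖pairCLM p q‖ = ‖q‖ := by
  refine le_antisymm ?_
    (ContinuousLinearMap.opNorm_le_bound q (norm_nonneg (pairCLM p q)) fun f => ?_)
  · have h1 : ‖pairCLM p q‖ ≤ max ‖p‖ ‖q‖ :=
      LinearMap.mkContinuous_norm_le _ (le_max_of_le_left (norm_nonneg p)) _
    exact h1.trans (max_eq_right h).le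
  · exact ((pairCLM p q f).norm_coe_le_norm ⟨false⟩).trans ((pairCLM p q).le_opNorm f)

theorem isBanachLatticeHom_pairCLM [Lattice X] {p q : X →L[ℝ] ℝ} (hp : IsBanachLatticeHom p)
    (hq : IsBanachLatticeHom q) : IsBanachLatticeHom (pairCLM p q) := by
  intro f g
  constructor
  · ext ⟨b⟩
    cases b
    · exact (hq f g).1
    · exact (hp f g).1
  · ext ⟨b⟩
    cases b
    · exact (hq f g).2
    · exact (hp f g).2

end Pair

section Universal

instance {A : Type*} [TopologicalSpace A] : IsOrderedModule ℝ (A →ᵇ ℝ) where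
  smul_le_smul_of_nonneg_left _ hc _ _ h φ := mul_le_mul_of_nonneg_left (h φ) hc
  smul_le_smul_of_nonneg_right _ hf _ _ h φ := mul_le_mul_of_nonneg_right h (hf φ)

/-- A uniformly bounded continuous family of real-valued lattice homomorphisms, as a lattice
homomorphism to a space of bounded continuous functions. -/
noncomputable def boundedFamily {L : Type*} [Lattice L] {A : Type*} [TopologicalSpace A]
    (g : A → LatticeHom L ℝ) (hg : ∀ x, Continuous fun a => g a x) (C : ℝ)
    (hC : ∀ a x, |g a x| ≤ C) : LatticeHom L (A →ᵇ ℝ) where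
  toFun x := BoundedContinuousFunction.ofNormedAddCommGroup (fun a => g a x) (hg x) C
    (fun a => hC a x)
  map_sup' x y := by
    ext a
    exact SupHomClass.map_sup (g a) x y
  map_inf' x y := by
    ext a
    exact InfHomClass.map_inf (g a) x y

theorem bddAbove_norm_boundedFamily {L : Type*} [Lattice L] {A : Type*} [TopologicalSpace A]
    (g : A → LatticeHom L ℝ) (hg : ∀ x, Continuous fun a => g a x) {C : ℝ} (hC0 : 0 ≤ C)
    (hC : ∀ a x, |g a x| ≤ C) : BddAbove (Set.range fun x => ‖boundedFamily g hg C hC x‖) :=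
  ⟨C, by
    rintro _ ⟨x, rfl⟩
    exact (BoundedContinuousFunction.norm_le hC0).2 fun a => hC a x⟩

/-- The constant lattice homomorphism. -/
def constHom (L : Type*) [Lattice L] (c : ℝ) : LatticeHom L ℝ where
  toFun _ := c
  map_sup' _ _ := (sup_idem c).symm
  map_inf' _ _ := (inf_idem c).symm

variable {L X : Type u} [Lattice L] [NormedAddCommGroup X] [NormedSpace ℝ X]
  [CompleteSpace X] [Lattice X] [IsOrderedAddMonoid X] [IsOrderedModule ℝ X] [HasSolidNorm X]
  {δ : LatticeHom L X}

/-- A whole path is a single homomorphism from `L` to the bounded continuous functions on the line;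
its extension, evaluated at `t`, is continuous in `t`. `ULift` puts the target in the universe of
the universal property. -/
theorem IsFreeBanachLattice.extendsPaths (h : IsFreeBanachLattice δ) : ExtendsPaths δ := by
  intro Φ hΦ
  have hcont : ∀ x, Continuous fun a : ULift.{u} ℝ => (Φ a.down).toReal x := fun x =>
    (hΦ x).comp continuous_uliftDown
  obtain ⟨S, ⟨hS, hSδ, -⟩, -⟩ := h.2 (ULift.{u} ℝ →ᵇ ℝ)
    (boundedFamily (fun a => (Φ a.down).toReal) hcont 1 fun a x => (Φ a.down).abs_le_one x)
    (bddAbove_norm_boundedFamily _ _ zero_le_one _)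
  refine ⟨fun t => (BoundedContinuousFunction.evalCLM ℝ (ULift.up t)).comp S, fun t f g => ?_,
    fun f => (S f).continuous.comp continuous_uliftUp, fun t x => ?_⟩
  · change S (f ⊔ g) (ULift.up t) = S f (ULift.up t) ⊔ S g (ULift.up t) ∧
      S (f ⊓ g) (ULift.up t) = S f (ULift.up t) ⊓ S g (ULift.up t)
    rw [(hS f g).1, (hS f g).2]
    exact ⟨rfl, rfl⟩
  · change S (δ x) (ULift.up t) = _
    rw [hSδ]
    rfl

/-- A constant `c ≥ 0` on `L` extends to a Banach lattice homomorphism of norm `c`. -/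
theorem IsFreeBanachLattice.exists_extension_const [Nonempty L] (h : IsFreeBanachLattice δ)
    {c : ℝ} (hc : 0 ≤ c) :
    ∃ q : X →L[ℝ] ℝ, IsBanachLatticeHom q ∧ (∀ x, q (δ x) = c) ∧ ‖q‖ = c := by
  obtain ⟨S, ⟨hS, hSδ, hSn⟩, -⟩ := h.2 (PUnit.{u + 1} →ᵇ ℝ)
    (boundedFamily (fun _ => constHom L c) (fun _ => continuous_const) c
      fun _ _ => (abs_of_nonneg hc).le)
    (bddAbove_norm_boundedFamily _ _ hc _)
  have hn : ∀ f : PUnit.{u + 1} →ᵇ ℝ, ‖f‖ = |f PUnit.unit| := fun f =>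
    le_antisymm ((BoundedContinuousFunction.norm_le (abs_nonneg _)).2 fun _ => le_rfl)
      (f.norm_coe_le_norm _)
  have hSn : ‖S‖ = c := by
    rw [hSn]
    simp only [hn]
    exact (ciSup_const (a := |c|)).trans (abs_of_nonneg hc)
  refine ⟨(BoundedContinuousFunction.evalCLM ℝ PUnit.unit).comp S, fun f g => ?_,
    fun x => ?_, ?_⟩
  · change S (f ⊔ g) PUnit.unit = S f PUnit.unit ⊔ S g PUnit.unit ∧
      S (f ⊓ g) PUnit.unit = S f PUnit.unit ⊓ S g PUnit.unit
    rw [(hS f g).1, (hS f g).2]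
    exact ⟨rfl, rfl⟩
  · change S (δ x) PUnit.unit = _
    rw [hSδ]
    rfl
  · rw [← hSn]
    refine le_antisymm (ContinuousLinearMap.opNorm_le_bound _ (norm_nonneg _) fun f => ?_)
      (ContinuousLinearMap.opNorm_le_bound _ (norm_nonneg _) fun f => ?_)
    · exact ((S f).norm_coe_le_norm _).trans (S.le_opNorm f)
    · rw [hn]
      exact ContinuousLinearMap.le_opNorm
        ((BoundedContinuousFunction.evalCLM ℝ PUnit.unit).comp S) f

/-- The universal property forces uniqueness of extensions without a restriction on the norm:
pair two extensions with a functional of large norm. -/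
theorem IsFreeBanachLattice.determinesHoms [Nonempty L] (h : IsFreeBanachLattice δ) :
    DeterminesHoms δ := by
  intro p q hp hq hpq
  obtain ⟨D, hD⟩ := h.1
  have hD : ∀ x, ‖δ x‖ ≤ D := fun x => hD ⟨x, rfl⟩
  have hD0 : 0 ≤ D := (norm_nonneg _).trans (hD (Classical.arbitrary L))
  -- The factor `D + 1` makes `c` dominate both the norms of `p` and `q` and their values on every
  -- `δ x`. Hence `k`, which is `c` on `L`, dictates both the operator norm of each pair and the
  -- supremum over `L`, so the norm clause of the universal property holds for both pairs.
  set c : ℝ := max ‖p‖ ‖q‖ * (D + 1) with hc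
  have hm : 0 ≤ max ‖p‖ ‖q‖ := le_max_of_le_left (norm_nonneg p)
  have hc0 : 0 ≤ c := mul_nonneg hm (by linarith)
  have hmc : max ‖p‖ ‖q‖ ≤ c := le_mul_of_one_le_right hm (by linarith)
  obtain ⟨k, hk, hkδ, hkn⟩ := h.exists_extension_const hc0
  have hpc : ∀ x, |p (δ x)| ≤ c := fun x => by
    refine (p.le_opNorm (δ x)).trans (mul_le_mul (le_max_left _ _) ?_ (norm_nonneg _) hm)
    linarith [hD x]
  let T : LatticeHom L (ULift.{u} Bool →ᵇ ℝ) :=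
    { toFun := fun x => pairCLM p k (δ x)
      map_sup' := fun x y => by
        rw [SupHomClass.map_sup, (isBanachLatticeHom_pairCLM hp hk _ _).1]
      map_inf' := fun x y => by
        rw [InfHomClass.map_inf, (isBanachLatticeHom_pairCLM hp hk _ _).2] }
  have hT : ∀ x, ‖T x‖ = c := by
    intro x
    refine le_antisymm ((BoundedContinuousFunction.norm_le hc0).2 ?_) ?_
    · rintro ⟨b⟩
      cases b
      · change |k (δ x)| ≤ c
        rw [hkδ, abs_of_nonneg hc0]
      · exact hpc x
    · have h1 := (T x).norm_coe_le_norm ⟨false⟩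
      change |k (δ x)| ≤ _ at h1
      rwa [hkδ, abs_of_nonneg hc0] at h1
  have hsup : ⨆ x, ‖T x‖ = c := by
    simp only [hT]
    exact ciSup_const
  have huniq := (h.2 _ T ⟨c, by rintro _ ⟨x, rfl⟩; exact (hT x).le⟩).unique
    (y₁ := pairCLM p k) (y₂ := pairCLM q k)
    ⟨isBanachLatticeHom_pairCLM hp hk, fun _ => rfl, by
      rw [hsup, norm_pairCLM (hkn ▸ (le_max_left _ _).trans hmc), hkn]⟩
    ⟨isBanachLatticeHom_pairCLM hq hk, fun x => by
      ext ⟨b⟩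
      cases b
      · rfl
      · exact (hpq x).symm, by
      rw [hsup, norm_pairCLM (hkn ▸ (le_max_right _ _).trans hmc), hkn]⟩
  ext f
  exact congrArg (fun S : X →L[ℝ] (ULift.{u} Bool →ᵇ ℝ) => S f ⟨true⟩) huniq

end Universal

end FreeBL

theorem corollary5p5 {L : Type u} [DistribLattice L] (hL : 2 ≤ Cardinal.mk L) :
    (¬ FreeBL.DedekindSigmaComplete (FreeBL.FBL L) ∧
      ¬ FreeBL.OrderContinuousNorm (FreeBL.FBL L) ∧
      ∀ a : FreeBL.FBL L, ¬ FreeBL.IsVectorAtom a) ∧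
    ∀ (X : Type u) [NormedAddCommGroup X] [NormedSpace ℝ X] [CompleteSpace X] [Lattice X]
      [IsOrderedAddMonoid X] [IsOrderedModule ℝ X] [HasSolidNorm X] (δ : LatticeHom L X),
      FreeBL.IsFreeBanachLattice δ →
        ¬ FreeBL.DedekindSigmaComplete X ∧
        ¬ FreeBL.OrderContinuousNorm X ∧
        ∀ a : X, ¬ FreeBL.IsVectorAtom a := by
  have : Nonempty L := by
    obtain ⟨x, -⟩ := Cardinal.two_le_iff.1 hL
    exact ⟨x⟩
  refine ⟨FreeBL.no_order_properties hL FreeBL.FBL.bddAbove_norm_delta FreeBL.FBL.extendsPaths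
    FreeBL.FBL.determinesHoms, ?_⟩
  intro X _ _ _ _ _ _ _ δ hδ
  exact FreeBL.no_order_properties hL hδ.1 hδ.extendsPaths hδ.determinesHoms
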